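/- Let $p$ be an odd prime, let $r,s\ge 0$ and $n\ge 1$ be integers, let $A\in\mathrm{Mat}_{r,s}(\mathbb Z_p)$ and $b\in\mathbb Z_p^r$, and write $\omega=e^{2\pi i/p}$. Let $\Gamma$ be the solution group of the linear constraint system (LCS) $Ax=b \bmod p$, that is, the group generated by $x_1,\dots,x_s,J$ subject to the relations $$x_k^p=J^p=1,\qquad [x_k,J]=1,\qquad [x_k,x_{k'}]=1 \text{ whenever } A_{jk}\neq 0\neq A_{jk'} \text{ for some } j,\qquad \prod_{k=1}^s x_k^{A_{jk}}=J^{b_j}\ \ (1\le j\le r).$$ Let $N_{SU(p)}(p)$ be the group of monomial matrices in $SU(p)$, i.e. of all $U\in SU(p)$ of the form $U=\Pi_\sigma\,\mathrm{diag}(\xi(0),\dots,\xi(p-1))$, where $\Pi_\sigma$ is the permutation matrix of some $\sigma\in S_p$ and $|\xi(q)|=1$ for all $q$; and let $N_{SU(p)}^{\otimes n}(p)=\{M_1\otimes\cdots\otimes M_n \mid M_k\in N_{SU(p)}(p)\}\le U(p^n)$. A quantum solution of the LCS with values in $N_{SU(p)}^{\otimes n}(p)$ is a group homomorphism $\eta:\Gamma\to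 N_{SU(p)}^{\otimes n}(p)$ with $\eta(J)=\omega\mathbb 1$. A classical solution is a group homomorphism $\eta:\Gamma\to\mathbb Z_p$ with $\eta(J)=1$ (equivalently, a vector $\tilde x\in\mathbb Z_p^s$ with $A\tilde x=b$). Then the LCS admits a quantum solution $\eta:\Gamma\to N_{SU(p)}^{\otimes n}(p)$ if and only if it admits a classical solution $\eta:\Gamma\to\mathbb Z_p$. -/

import Mathlib

open scoped Matrix

/-! ### Linear constraint systems `A x = b` over `ZMod d` and their solution groups -/

/-- Generators of the solution group: the variables `x k` and the central element `J`. -/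
inductive LCSGen (s : ℕ) : Type
  | x (k : Fin s) : LCSGen s
  | J : LCSGen s

/-- The ordered product `∏ₖ yₖ ^ (A j k)` of row `j`, for elements `y k` of a group.
The exponent is the representative of `A j k` in `{0, …, d - 1}`. -/
def lcsRowProd {d r s : ℕ} {G : Type*} [Group G] (A : Matrix (Fin r) (Fin s) (ZMod d))
    (y : Fin s → G) (j : Fin r) : G :=
  (List.ofFn fun k => y k ^ (A j k).val).prod

open scoped commutatorElement in
/-- Defining relators of the solution group of `A x = b`. -/
inductive LCSRel {d r s : ℕ} (A : Matrix (Fin r) (Fin s) (ZMod d)) (b : Fin r → ZMod d) :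
    FreeGroup (LCSGen s) → Prop
  | torsion_x (k : Fin s) : LCSRel A b (FreeGroup.of (LCSGen.x k) ^ d)
  | torsion_J : LCSRel A b (FreeGroup.of LCSGen.J ^ d)
  | central (k : Fin s) : LCSRel A b ⁅FreeGroup.of (LCSGen.x k), FreeGroup.of LCSGen.J⁆
  | comm (j : Fin r) (k k' : Fin s) (hk : A j k ≠ 0) (hk' : A j k' ≠ 0) :
      LCSRel A b ⁅FreeGroup.of (LCSGen.x k), FreeGroup.of (LCSGen.x k')⁆
  | constraint (j : Fin r) :
      LCSRel A b (lcsRowProd A (fun k => FreeGroup.of (LCSGen.x k)) j *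
        (FreeGroup.of LCSGen.J ^ (b j).val)⁻¹)

/-- The solution group `Γ` of the linear constraint system `A x = b` over `ZMod d`. -/
abbrev SolutionGroup {d r s : ℕ} (A : Matrix (Fin r) (Fin s) (ZMod d)) (b : Fin r → ZMod d) :
    Type :=
  PresentedGroup {g | LCSRel A b g}

/-- The distinguished central generator `J` of the solution group. -/
def SolutionGroup.J {d r s : ℕ} (A : Matrix (Fin r) (Fin s) (ZMod d)) (b : Fin r → ZMod d) :
    SolutionGroup A b :=
  PresentedGroup.of LCSGen.J

/-- A classical solution `η : Γ → ZMod d`: a homomorphism sending `J` to `1 : ZMod d`. -/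
def IsClassicalSolution {d r s : ℕ} {A : Matrix (Fin r) (Fin s) (ZMod d)} {b : Fin r → ZMod d}
    (η : SolutionGroup A b →* Multiplicative (ZMod d)) : Prop :=
  η (SolutionGroup.J A b) = Multiplicative.ofAdd 1

/-- Homomorphisms `Γ → G` with `J ↦ z` amount to assignments `y` of elements of `G` to the
variables that have `d`-torsion, commute within each row and satisfy `∏ₖ yₖ ^ (A j k) = z ^ b j`. -/
theorem SolutionGroup.exists_hom_iff {d r s : ℕ} {A : Matrix (Fin r) (Fin s) (ZMod d)}
    {b : Fin r → ZMod d} {G : Type*} [Group G] (z : G) (hz : z ^ d = 1)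
    (hc : ∀ g : G, Commute g z) :
    (∃ η : SolutionGroup A b →* G, η (SolutionGroup.J A b) = z) ↔
      ∃ y : Fin s → G, (∀ k, y k ^ d = 1) ∧
        (∀ j k k', A j k ≠ 0 → A j k' ≠ 0 → Commute (y k) (y k')) ∧
        ∀ j, lcsRowProd A y j = z ^ (b j).val := by
  constructor
  · rintro ⟨η, rfl⟩
    have key : ∀ g, LCSRel A b g → η (PresentedGroup.mk _ g) = 1 := fun g hg => by
      rw [PresentedGroup.one_of_mem (rels := {g | LCSRel A b g}) hg, map_one]
    refine ⟨fun k => η (PresentedGroup.of (LCSGen.x k)), fun k => ?_, fun j k k' hk hk' => ?_,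
      fun j => ?_⟩
    · simpa [PresentedGroup.of] using key _ (.torsion_x k)
    · simpa [PresentedGroup.of, commutatorElement_eq_one_iff_commute] using
        key _ (.comm j k k' hk hk')
    · have h := key _ (.constraint j)
      rw [map_mul, map_mul, map_inv, map_inv, mul_inv_eq_one] at h
      simpa [lcsRowProd, map_list_prod, List.map_ofFn, Function.comp_def, PresentedGroup.of,
        SolutionGroup.J] using h
  · rintro ⟨y, h1, h2, h3⟩
    refine ⟨PresentedGroup.toGroup (f := fun g => LCSGen.rec y z g) ?_, ?_⟩
    · rintro _ (k | _ | k | ⟨j, k, k', hk, hk'⟩ | j)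
      · simpa using h1 k
      · simpa using hz
      · simpa [commutatorElement_eq_one_iff_commute] using hc (y k)
      · simpa [commutatorElement_eq_one_iff_commute] using h2 j k k' hk hk'
      · rw [map_mul, map_inv, mul_inv_eq_one]
        simpa [lcsRowProd, map_list_prod, List.map_ofFn, Function.comp_def] using h3 j
    · simp [SolutionGroup.J]

/-- Classical solutions `Γ → ZMod d` exist exactly when `A x = b` is solvable. -/
theorem exists_isClassicalSolution_iff {d r s : ℕ} [NeZero d]
    (A : Matrix (Fin r) (Fin s) (ZMod d)) (b : Fin r → ZMod d) :
    (∃ η : SolutionGroup A b →* Multiplicative (ZMod d), IsClassicalSolution η) ↔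
      ∃ x : Fin s → ZMod d, A *ᵥ x = b := by
  have tors : ∀ a : Multiplicative (ZMod d), a ^ d = 1 := fun a => by
    apply Multiplicative.toAdd.injective
    simp [toAdd_pow]
  refine (SolutionGroup.exists_hom_iff _ (tors _) fun g => Commute.all _ _).trans ?_
  have row : ∀ (y : Fin s → Multiplicative (ZMod d)) (j : Fin r),
      lcsRowProd A y j = Multiplicative.ofAdd 1 ^ (b j).val ↔
        (A *ᵥ fun k => (y k).toAdd) j = b j := by
    intro y j
    rw [← Multiplicative.toAdd.injective.eq_iff]
    simp [lcsRowProd, List.prod_ofFn, toAdd_prod, toAdd_pow, Matrix.mulVec, dotProduct]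
  constructor
  · rintro ⟨y, -, -, h⟩
    exact ⟨fun k => (y k).toAdd, funext fun j => (row y j).mp (h j)⟩
  · rintro ⟨x, rfl⟩
    exact ⟨fun k => Multiplicative.ofAdd (x k), fun k => tors _, fun _ _ _ _ _ => Commute.all _ _,
      fun j => (row _ j).mpr rfl⟩

/-- The scalar `ω = exp (2 π i / d)`. -/
noncomputable def rootOmega (d : ℕ) : ℂ :=
  Complex.exp (2 * Real.pi * Complex.I / d)

/-- A quantum solution `η : Γ → G` with values in a group `G` of unitary matrices: a homomorphism
sending `J` to `ω • 1`. -/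
def IsQuantumSolution {d r s : ℕ} {A : Matrix (Fin r) (Fin s) (ZMod d)} {b : Fin r → ZMod d}
    {m : Type*} [Fintype m] [DecidableEq m] {G : Subgroup (Matrix.unitaryGroup m ℂ)}
    (η : SolutionGroup A b →* G) : Prop :=
  ((η (SolutionGroup.J A b) : Matrix.unitaryGroup m ℂ) : Matrix m m ℂ) =
    rootOmega d • (1 : Matrix m m ℂ)

/-! ### Monomial special unitary matrices -/

/-- `U = Π_σ S_ξ`, where `Π_σ` maps the basis vector `e q` to `e (σ q)` and
`S_ξ = diag (ξ q)` with `ξ q` of modulus one. -/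
def IsMonomialUnitary {ι : Type*} [Fintype ι] [DecidableEq ι] (U : Matrix ι ι ℂ) : Prop :=
  ∃ (σ : Equiv.Perm ι) (ξ : ι → Circle),
    U = (σ⁻¹).permMatrix ℂ * Matrix.diagonal fun q => (ξ q : ℂ)

theorem monomial_apply {ι : Type*} [Fintype ι] [DecidableEq ι] (σ : Equiv.Perm ι)
    (ξ : ι → Circle) (i j : ι) :
    ((σ⁻¹).permMatrix ℂ * Matrix.diagonal fun q => (ξ q : ℂ)) i j =
      if i = σ j then (ξ j : ℂ) else 0 := by
  rw [Matrix.mul_diagonal]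
  simp only [Equiv.Perm.permMatrix, PEquiv.toMatrix_apply, Equiv.toPEquiv_apply,
    Option.mem_some_iff, Equiv.Perm.inv_eq_iff_eq]
  split_ifs <;> simp

/-- The group `N_{SU}` of monomial special unitary matrices, as a group of unitary matrices. -/
def monomialSU (ι : Type*) [Fintype ι] [DecidableEq ι] : Subgroup (Matrix.unitaryGroup ι ℂ) where
  carrier := {U | (U : Matrix ι ι ℂ) ∈ Matrix.specialUnitaryGroup ι ℂ ∧
    IsMonomialUnitary (U : Matrix ι ι ℂ)}
  one_mem' := by
    refine ⟨one_mem _, 1, 1, ?_⟩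
    ext i j
    rw [monomial_apply]
    by_cases h : i = j <;> simp [h]
  mul_mem' := by
    rintro U V ⟨hU, σ, ξ, hσ⟩ ⟨hV, τ, χ, hτ⟩
    refine ⟨mul_mem hU hV, σ * τ, fun q => ξ (τ q) * χ q, ?_⟩
    ext i j
    rw [monomial_apply, Matrix.UnitaryGroup.mul_val, hσ, hτ, Matrix.mul_apply]
    simp only [monomial_apply]
    by_cases h : i = σ (τ j) <;> simp [h]
  inv_mem' := by
    rintro U ⟨hU, σ, ξ, hσ⟩
    refine ⟨(⟨_, hU⟩ : Matrix.specialUnitaryGroup ι ℂ)⁻¹.2, σ⁻¹, fun q => (ξ (σ⁻¹ q))⁻¹, ?_⟩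
    ext i j
    rw [monomial_apply, Matrix.UnitaryGroup.inv_val, Matrix.star_apply, hσ, monomial_apply]
    by_cases h : i = σ⁻¹ j
    · subst h
      simp [← Circle.coe_inv_eq_conj]
    · have h' : ¬ j = σ i := by
        rintro rfl
        simp at h
      rw [if_neg h, if_neg h', star_zero]

/-! ### Tensor powers -/

/-- The tensor (Kronecker) product `M 0 ⊗ ⋯ ⊗ M (n - 1)`, in the product basis indexed by
`Fin n → ι`. -/
def tensorMatrix {ι : Type*} {n : ℕ} (M : Fin n → Matrix ι ι ℂ) :
    Matrix (Fin n → ι) (Fin n → ι) ℂ :=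
  Matrix.of fun i j => ∏ k, M k (i k) (j k)

theorem tensorMatrix_mul {ι : Type*} [Fintype ι] {n : ℕ} (M M' : Fin n → Matrix ι ι ℂ) :
    tensorMatrix (fun k => M k * M' k) = tensorMatrix M * tensorMatrix M' := by
  classical
  ext i j
  simp only [tensorMatrix, Matrix.of_apply, Matrix.mul_apply, Finset.prod_univ_sum,
    Fintype.piFinset_univ, Finset.prod_mul_distrib]

theorem tensorMatrix_one {ι : Type*} [DecidableEq ι] {n : ℕ} :
    tensorMatrix (fun _ : Fin n => (1 : Matrix ι ι ℂ)) = 1 := by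
  ext i j
  by_cases h : i = j
  · subst h
    simp [tensorMatrix]
  · obtain ⟨k, hk⟩ := Function.ne_iff.mp h
    rw [Matrix.one_apply_ne h]
    exact Finset.prod_eq_zero (Finset.mem_univ k) (Matrix.one_apply_ne hk)

theorem tensorMatrix_star {ι : Type*} {n : ℕ} (M : Fin n → Matrix ι ι ℂ) :
    star (tensorMatrix M) = tensorMatrix fun k => star (M k) := by
  ext i j
  simp [tensorMatrix, Matrix.star_apply]

/-- The tensor product of unitaries as a homomorphism `U(ι)ⁿ → U(ιⁿ)`. -/
def tensorHom (ι : Type*) [Fintype ι] [DecidableEq ι] (n : ℕ) :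
    (Fin n → Matrix.unitaryGroup ι ℂ) →* Matrix.unitaryGroup (Fin n → ι) ℂ where
  toFun M := ⟨tensorMatrix fun k => (M k : Matrix ι ι ℂ), by
    rw [Matrix.mem_unitaryGroup_iff, tensorMatrix_star, ← tensorMatrix_mul, ← tensorMatrix_one]
    congr 1
    ext1 k
    exact Matrix.mem_unitaryGroup_iff.mp (M k).2⟩
  map_one' := Subtype.ext tensorMatrix_one
  map_mul' M M' := Subtype.ext (tensorMatrix_mul _ _)

/-- The group `G^{⊗n}` of all tensor products `M 0 ⊗ ⋯ ⊗ M (n - 1)` with factors in `G`. -/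
def tensorPower {ι : Type*} [Fintype ι] [DecidableEq ι] (G : Subgroup (Matrix.unitaryGroup ι ℂ))
    (n : ℕ) : Subgroup (Matrix.unitaryGroup (Fin n → ι) ℂ) :=
  (Subgroup.pi Set.univ fun _ : Fin n => G).map (tensorHom ι n)

/-! A classical solution gives scalars `ω ^ x k`. For the converse, a function to `ℂ` is built on
tuples of monomial matrices that sends any tuple whose tensor is `w • 1`, `w ≠ 0`, to `w`, and is
multiplicative when the tensors commute and have `p`-th power one. It takes the matrices of a
quantum solution to powers of `ω`, whose exponents solve `A x = b`.

Commuting tensors have factors that commute only up to scalars, and these scalars multiply to 1. So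
it suffices to have, on each factor, a function `v` on elements with scalar `p`-th power satisfying
`v (g h) = v g * v h * [g, h] ^ (1/2)` whenever `[g, h]` is scalar, with 1/2 read modulo `p`; the
corrections cancel in the product over factors (`extend_mul`, `tensorChar_mul`).

On diagonal matrices `v` is the `(0, 0)` entry. A non-diagonal `E` with scalar `p`-th power permutes
the basis by a `p`-cycle, which is its own centralizer up to powers. Hence whatever commutes with
`E` up to scalars is `E ^ k * D * E ^ k` with `D` diagonal, and `v` is read off `D`; this symmetric
form produces exactly the half commutator (`exists_twist`). Commuting up to scalars is an
equivalence relation on such non-diagonal elements, so one `E` per class defines `v` consistently.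
-/

open scoped commutatorElement

/-! ### Abstract monomial extensions. -/

/-- A group `G` with a homomorphism `π` whose kernel is abelian, a central subgroup `Z ≤ ker π` of
exponent `p`, and a function `χ` that is multiplicative on `ker π`, such that every
element `g ∉ ker π` with `g ^ p ∈ Z` has order `p` and generates, under `π`, the image of its
projective centralizer. -/
structure IsMonomialExtension {G P C : Type*} [Group G] [Group P] [CommMonoid C] (p : ℕ)
    (π : G →* P) (Z : Subgroup G) (χ : G → C) : Prop where
  comm : ∀ z ∈ Z, ∀ g, Commute z g
  torsion : ∀ z ∈ Z, z ^ p = 1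
  le_ker : ∀ z ∈ Z, π z = 1
  ker_comm : ∀ g h, π g = 1 → π h = 1 → Commute g h
  char_mul : ∀ g h, π g = 1 → π h = 1 → χ (g * h) = χ g * χ h
  char_one : χ 1 = 1
  pow_eq_one : ∀ g, g ^ p ∈ Z → π g ≠ 1 → g ^ p = 1
  exists_zpow : ∀ g h, g ^ p ∈ Z → π g ≠ 1 → ⁅g, h⁆ ∈ Z → ∃ m : ℤ, π h = π g ^ m

theorem mul_zpow_of_mul_eq {G : Type*} [Group G] {z D E : G} (hz : ∀ g, Commute z g)
    (h : D * E = z * E * D) (b : ℤ) : D * E ^ b = z ^ b * (E ^ b * D) := by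
  have h1 : SemiconjBy D E (z * E) := h
  rw [← mul_assoc, ← (hz E).mul_zpow]
  exact h1.zpow_right b

/-- Elements that commute with `E` up to `Z`, as a set. -/
def projCentralizer {G : Type*} [Group G] (Z : Subgroup G) (E : G) : Set G := {h | ⁅E, h⁆ ∈ Z}

namespace IsMonomialExtension

variable {G P C : Type*} [Group G] [Group P] [CommMonoid C] {p : ℕ}
  {π : G →* P} {Z : Subgroup G} {χ : G → C}

theorem commutator_mem_symm {g h : G} (hgh : ⁅g, h⁆ ∈ Z) : ⁅h, g⁆ ∈ Z := by
  rw [← commutatorElement_inv]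
  exact Z.inv_mem hgh

/-- Both `E` and `π E` are killed by `p`, and 2 is invertible modulo `p`. This makes the
normalisation in `twist` independent of the chosen `k`. -/
theorem zpow_eq_zpow (H : IsMonomialExtension p π Z χ) [Fact p.Prime] (hp : Odd p) {E : G}
    (hE : E ^ p ∈ Z) (hE1 : π E ≠ 1) {k l : ℤ} (h : π E ^ (2 * k) = π E ^ (2 * l)) :
    E ^ k = E ^ l := by
  have hE2 := H.pow_eq_one E hE hE1
  have ho : orderOf (π E) = p := orderOf_eq_prime (by rw [← map_pow, hE2, map_one]) hE1
  rw [zpow_eq_zpow_iff_modEq, ho] at h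
  have h3 : k ≡ l [ZMOD p] := by
    rw [Int.modEq_iff_dvd] at h ⊢
    rw [← mul_sub] at h
    refine IsCoprime.dvd_of_dvd_mul_left ?_ h
    rw [← Int.cast_ofNat (R := ℤ)]
    exact (Nat.isCoprime_iff_coprime (m := p) (n := 2)).mpr hp.coprime_two_right
  rw [zpow_eq_zpow_iff_modEq]
  exact h3.of_dvd (by exact_mod_cast orderOf_dvd_of_pow_eq_one hE2)

theorem exists_eq_zpow_mul_mul_zpow (H : IsMonomialExtension p π Z χ) [Fact p.Prime] (hp : Odd p)
    {E X : G} (hE : E ^ p ∈ Z) (hE1 : π E ≠ 1) (hX : ⁅E, X⁆ ∈ Z) :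
    ∃ (k : ℤ) (D z : G), X = E ^ k * D * E ^ k ∧ π D = 1 ∧ z ∈ Z ∧ D * E = z * E * D ∧
      π X = π E ^ (2 * k) := by
  obtain ⟨m, hm⟩ := H.exists_zpow E X hE hE1 hX
  have hE2 := H.pow_eq_one E hE hE1
  obtain ⟨q, hq⟩ := hp
  -- As `p = 2q + 1`, the factor `q + 1` is the inverse of 2 modulo `p`: half of the power `E ^ m`
  -- goes on each side.
  have hk : π X = π E ^ (2 * (m * (q + 1))) := by
    have : 2 * (m * (q + 1)) = m + (p : ℤ) * m := by rw [hq]; push_cast; ring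
    rw [this, zpow_add, zpow_mul, zpow_natCast, ← map_pow π E p, hE2, map_one, one_zpow, mul_one,
      hm]
  set k := m * (q + 1)
  have hXE : X * E = ⁅X, E⁆ * E * X := by simp [commutatorElement_def]
  refine ⟨k, E ^ (-k) * X * E ^ (-k), ⁅X, E⁆, by group, ?_, commutator_mem_symm hX, ?_, hk⟩
  · simp only [map_mul, map_zpow, hk, ← zpow_add]
    convert zpow_zero (π E) using 2
    ring
  · have hz := H.comm _ (commutator_mem_symm hX)
    have h1 : SemiconjBy X E (⁅X, E⁆ * E) := hXE
    have h2 : SemiconjBy (E ^ (-k)) (⁅X, E⁆ * E) (⁅X, E⁆ * E) :=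
      ((hz _).symm.mul_right ((Commute.refl E).zpow_left _))
    have h3 : SemiconjBy (E ^ (-k)) E E := (Commute.refl E).zpow_left _
    exact (h2.mul_left h1).mul_left h3

/-- Moving `D` past `E ^ (2 * l)` costs `z ^ (2 * l)`, and moving `D'` past `E ^ (2 * k)` costs `z'
^ (2 * k)`. The symmetric form splits this cost evenly between the two orders of multiplication, so
`t = z ^ l * z' ^ (-k)` is a square root of the commutator. -/
theorem exists_twist (H : IsMonomialExtension p π Z χ) {E D D' z z' : G} {k l : ℤ}
    (hD : π D = 1) (hD' : π D' = 1) (hz : z ∈ Z) (hz' : z' ∈ Z)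
    (h : D * E = z * E * D) (h' : D' * E = z' * E * D') :
    ∃ t ∈ Z, (E ^ k * D * E ^ k) * (E ^ l * D' * E ^ l) =
        E ^ (k + l) * (t * (D * D')) * E ^ (k + l) ∧
      ⁅E ^ k * D * E ^ k, E ^ l * D' * E ^ l⁆ = t ^ 2 := by
  have cz := H.comm z hz
  have cz' := H.comm z' hz'
  have hDD := H.ker_comm D D' hD hD'
  have hm : D * D' * E = (z * z') * E * (D * D') := by
    have h1 : SemiconjBy D E (z * E) := h
    have h2 : SemiconjBy D' E (z' * E) := h'
    have h3 : SemiconjBy D z' z' := (cz' D).symm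
    rw [(cz z').eq, mul_assoc z']
    exact (h3.mul_right h1).mul_left h2
  have n1 := mul_zpow_of_mul_eq cz h
  have n2 := mul_zpow_of_mul_eq cz' h'
  have n3 := mul_zpow_of_mul_eq (fun g => (cz g).mul_left (cz' g)) hm
  have hX : E ^ k * D * E ^ k = z ^ k * (E ^ (2 * k) * D) := by
    rw [mul_assoc, n1, ← mul_assoc, ← ((cz _).zpow_left k).eq, mul_assoc, ← mul_assoc (E ^ k),
      ← zpow_add, two_mul]
  have hY : E ^ l * D' * E ^ l = z' ^ l * (E ^ (2 * l) * D') := by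
    rw [mul_assoc, n2, ← mul_assoc, ← ((cz' _).zpow_left l).eq, mul_assoc, ← mul_assoc (E ^ l),
      ← zpow_add, two_mul]
  have hXY : (E ^ k * D * E ^ k) * (E ^ l * D' * E ^ l) =
      z ^ k * z' ^ l * z ^ (2 * l) * (E ^ (2 * (k + l)) * (D * D')) := by
    rw [hX, hY, ((cz' _).zpow_left l).symm.mul_mul_mul_comm, mul_assoc (E ^ (2 * k)),
      ← mul_assoc D, n1, mul_assoc (z ^ (2 * l)), ← mul_assoc (E ^ (2 * k)),
      ← ((cz _).zpow_left (2 * l)).eq, mul_add, zpow_add]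
    simp only [mul_assoc]
  have hYX : (E ^ l * D' * E ^ l) * (E ^ k * D * E ^ k) =
      z' ^ l * z ^ k * z' ^ (2 * k) * (E ^ (2 * (k + l)) * (D * D')) := by
    rw [hX, hY, ((cz _).zpow_left k).symm.mul_mul_mul_comm, mul_assoc (E ^ (2 * l)),
      ← mul_assoc D', n2, mul_assoc (z' ^ (2 * k)), ← mul_assoc (E ^ (2 * l)),
      ← ((cz' _).zpow_left (2 * k)).eq, add_comm k, mul_add, zpow_add, hDD.eq]
    simp only [mul_assoc]
  have czp : ∀ (a : ℤ) g, Commute (z ^ a) g := fun a g => (cz g).zpow_left a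
  have czp' : ∀ (a : ℤ) g, Commute (z' ^ a) g := fun a g => (cz' g).zpow_left a
  have ct : ∀ g, Commute (z ^ l * z' ^ (-k)) g := fun g => (czp l g).mul_left (czp' (-k) g)
  refine ⟨z ^ l * z' ^ (-k), Z.mul_mem (Z.zpow_mem hz _) (Z.zpow_mem hz' _), ?_, ?_⟩
  · rw [hXY, ← mul_assoc (E ^ (k + l)), ← (ct _).eq, mul_assoc _ (E ^ (k + l)),
      mul_assoc _ (E ^ (k + l) * (D * D')), mul_assoc (E ^ (k + l)), n3,
      ← mul_assoc (E ^ (k + l)), ← (((cz _).mul_left (cz' _)).zpow_left (k + l)).eq,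
      mul_assoc _ (E ^ (k + l)), ← mul_assoc (E ^ (k + l)), ← zpow_add, ← two_mul,
      ← mul_assoc _ (_ ^ (k + l)), (cz z').mul_zpow]
    congr 1
    rw [(czp' (-k) _).mul_mul_mul_comm, mul_assoc, (czp' l _).eq]
    group
  · rw [commutatorElement_def, mul_inv_eq_iff_eq_mul, mul_inv_eq_iff_eq_mul, hXY,
      mul_assoc (_ ^ 2), hYX, ← mul_assoc (_ ^ 2)]
    congr 1
    rw [(czp l _).mul_pow, ← (czp (2 * l) _).eq, ← (czp' (2 * k) _).eq, (czp' l (z ^ k)).eq]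
    group

/-! ### The character on one projective centralizer. -/

/-- The normalised value of `χ` on an element `X` of the projective centralizer of `E`. -/
noncomputable def twist (π : G →* P) (χ : G → C) (E X : G) : C :=
  open Classical in
  if h : ∃ k : ℤ, π X = π E ^ (2 * k) then χ (E ^ (-h.choose) * X * E ^ (-h.choose)) else χ X

theorem twist_eq (H : IsMonomialExtension p π Z χ) [Fact p.Prime] (hp : Odd p) {E X : G}
    (hE : E ^ p ∈ Z) (hE1 : π E ≠ 1) {k : ℤ} (hk : π X = π E ^ (2 * k)) :
    twist π χ E X = χ (E ^ (-k) * X * E ^ (-k)) := by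
  have h : ∃ k : ℤ, π X = π E ^ (2 * k) := ⟨k, hk⟩
  rw [twist, dif_pos h, zpow_neg, zpow_neg,
    H.zpow_eq_zpow hp hE hE1 (h.choose_spec.symm.trans hk)]

theorem twist_of_map_eq_one (H : IsMonomialExtension p π Z χ) [Fact p.Prime] (hp : Odd p)
    {E X : G} (hE : E ^ p ∈ Z) (hE1 : π E ≠ 1) (hX : π X = 1) : twist π χ E X = χ X := by
  rw [H.twist_eq hp hE hE1 (k := 0) (by simpa using hX)]
  simp

theorem char_pow (H : IsMonomialExtension p π Z χ) {z : G} (hz : z ∈ Z) (m : ℕ) :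
    χ (z ^ m) = χ z ^ m := by
  induction m with
  | zero => simp [H.char_one]
  | succ m ih =>
    rw [pow_succ, pow_succ, H.char_mul _ _ (H.le_ker _ (Z.pow_mem hz m)) (H.le_ker _ hz), ih]

/-- The correction is `χ t` with `t ^ 2 = ⁅X, Y⁆`; since `t ^ p = 1`, it is the commutator's value
to the power `(p + 1) / 2`. -/
theorem twist_mul (H : IsMonomialExtension p π Z χ) [Fact p.Prime] (hp : Odd p) {E X Y : G}
    (hE : E ^ p ∈ Z) (hE1 : π E ≠ 1) (hX : ⁅E, X⁆ ∈ Z) (hY : ⁅E, Y⁆ ∈ Z) :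
    twist π χ E (X * Y) = twist π χ E X * twist π χ E Y * χ ⁅X, Y⁆ ^ ((p + 1) / 2) := by
  obtain ⟨k, D, z, rfl, hD, hz, hzD, hk⟩ := H.exists_eq_zpow_mul_mul_zpow hp hE hE1 hX
  obtain ⟨l, D', z', rfl, hD', hz', hzD', hl⟩ := H.exists_eq_zpow_mul_mul_zpow hp hE hE1 hY
  obtain ⟨t, ht, h1, h2⟩ := H.exists_twist (k := k) (l := l) hD hD' hz hz' hzD hzD'
  have ht1 := H.le_ker t ht
  have cancel : ∀ (a : ℤ) (g : G), E ^ (-a) * (E ^ a * g * E ^ a) * E ^ (-a) = g := fun a g => by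
    group
  have hkl : π (E ^ k * D * E ^ k * (E ^ l * D' * E ^ l)) = π E ^ (2 * (k + l)) := by
    rw [map_mul, hk, hl, ← zpow_add, mul_add]
  rw [H.twist_eq hp hE hE1 hkl, H.twist_eq hp hE hE1 hk, H.twist_eq hp hE hE1 hl, h1, h2,
    cancel, cancel, cancel, H.char_mul _ _ ht1 (by rw [map_mul, hD, hD', one_mul]),
    H.char_mul _ _ hD hD', ← H.char_pow (Z.pow_mem ht 2), ← pow_mul,
    Nat.mul_div_cancel' hp.add_one.two_dvd, pow_succ, H.torsion t ht, one_mul, mul_comm]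

/-- Transitivity of commuting up to `Z` through an element outside `ker π`. -/
theorem commutator_mem (H : IsMonomialExtension p π Z χ) [Fact p.Prime] (hp : Odd p) {E X Y : G}
    (hE : E ^ p ∈ Z) (hE1 : π E ≠ 1) (hX : ⁅E, X⁆ ∈ Z) (hY : ⁅E, Y⁆ ∈ Z) : ⁅X, Y⁆ ∈ Z := by
  obtain ⟨k, D, z, rfl, hD, hz, hzD, -⟩ := H.exists_eq_zpow_mul_mul_zpow hp hE hE1 hX
  obtain ⟨l, D', z', rfl, hD', hz', hzD', -⟩ := H.exists_eq_zpow_mul_mul_zpow hp hE hE1 hY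
  obtain ⟨t, ht, -, h2⟩ := H.exists_twist (k := k) (l := l) hD hD' hz hz' hzD hzD'
  rw [h2]
  exact Z.pow_mem ht 2

/-! ### Gluing over projective centralizers. -/

theorem projCentralizer_eq (H : IsMonomialExtension p π Z χ) [Fact p.Prime] (hp : Odd p) {E F : G}
    (hE : E ^ p ∈ Z) (hE1 : π E ≠ 1) (hF : F ^ p ∈ Z) (hF1 : π F ≠ 1) (hEF : ⁅E, F⁆ ∈ Z) :
    projCentralizer Z E = projCentralizer Z F :=
  Set.Subset.antisymm (fun _ hX => H.commutator_mem hp hE hE1 hEF hX)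
    fun _ hX => H.commutator_mem hp hF hF1 (commutator_mem_symm hEF) hX

/-- A chosen element `E` with a given projective centralizer, among those with `E ^ p ∈ Z` and
`E ∉ ker π`. -/
noncomputable def representative (p : ℕ) (π : G →* P) (Z : Subgroup G) (S : Set G) : G :=
  Classical.epsilon fun E => E ^ p ∈ Z ∧ π E ≠ 1 ∧ projCentralizer Z E = S

/-- The extension of `χ` from `ker π` to all `g` with `g ^ p ∈ Z`. -/
noncomputable def extend (p : ℕ) (π : G →* P) (Z : Subgroup G) (χ : G → C) (g : G) : C :=
  open Classical in
  if π g = 1 then χ g else twist π χ (representative p π Z (projCentralizer Z g)) g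

omit [CommMonoid C] in
theorem extend_of_map_eq_one {g : G} (hg : π g = 1) : extend p π Z χ g = χ g := if_pos hg

/-- One `E` serves the whole projective centralizer of `F`: elements outside `ker π` share its
projective centralizer, hence its representative, and on `ker π` every twist equals `χ`. -/
theorem exists_extend_eq_twist (H : IsMonomialExtension p π Z χ) [Fact p.Prime] (hp : Odd p)
    {F : G} (hF : F ^ p ∈ Z) (hF1 : π F ≠ 1) :
    ∃ E, E ^ p ∈ Z ∧ π E ≠ 1 ∧ projCentralizer Z E = projCentralizer Z F ∧
      ∀ g, g ^ p ∈ Z → ⁅F, g⁆ ∈ Z → extend p π Z χ g = twist π χ E g := by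
  obtain ⟨hE, hE1, hEF⟩ := Classical.epsilon_spec
    (p := fun E => E ^ p ∈ Z ∧ π E ≠ 1 ∧ projCentralizer Z E = projCentralizer Z F)
    ⟨F, hF, hF1, rfl⟩
  refine ⟨_, hE, hE1, hEF, fun g hg hFg => ?_⟩
  by_cases hg1 : π g = 1
  · rw [extend_of_map_eq_one hg1, H.twist_of_map_eq_one hp hE hE1 hg1]
  · rw [extend, if_neg hg1, ← H.projCentralizer_eq hp hF hF1 hg hg1 hFg]
    rfl

theorem mul_pow_mem (H : IsMonomialExtension p π Z χ) {g h : G} (hg : g ^ p ∈ Z)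
    (hh : h ^ p ∈ Z) (hgh : ⁅g, h⁆ ∈ Z) : (g * h) ^ p ∈ Z := by
  have hn : Z.Normal := ⟨fun z hz g => by rwa [← (H.comm z hz g).eq, mul_inv_cancel_right]⟩
  rw [← QuotientGroup.eq_one_iff] at hg hh hgh ⊢
  have hc : Commute (g : G ⧸ Z) (h : G ⧸ Z) := by
    rw [← commutatorElement_eq_one_iff_commute]
    exact hgh
  rw [QuotientGroup.mk_pow] at hg hh ⊢
  rw [QuotientGroup.mk_mul, hc.mul_pow, hg, hh, one_mul]

theorem extend_mul (H : IsMonomialExtension p π Z χ) [Fact p.Prime] (hp : Odd p) {g h : G}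
    (hg : g ^ p ∈ Z) (hh : h ^ p ∈ Z) (hgh : ⁅g, h⁆ ∈ Z) :
    extend p π Z χ (g * h) =
      extend p π Z χ g * extend p π Z χ h * χ ⁅g, h⁆ ^ ((p + 1) / 2) := by
  have hself : ∀ a : G, ⁅a, a⁆ ∈ Z := fun a => by simp
  have key : ∀ F, F ^ p ∈ Z → π F ≠ 1 → ⁅F, g⁆ ∈ Z → ⁅F, h⁆ ∈ Z →
      extend p π Z χ (g * h) =
        extend p π Z χ g * extend p π Z χ h * χ ⁅g, h⁆ ^ ((p + 1) / 2) := by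
    intro F hF hF1 hFg hFh
    obtain ⟨E, hE, hE1, hEF, he⟩ := H.exists_extend_eq_twist hp hF hF1
    have hFgh : ⁅F, g * h⁆ ∈ Z := by
      have : ⁅F, g * h⁆ = ⁅F, g⁆ * (g * ⁅F, h⁆ * g⁻¹) := by
        simp only [commutatorElement_def]
        group
      rw [this, ← (H.comm _ hFh g).eq, mul_inv_cancel_right]
      exact Z.mul_mem hFg hFh
    rw [he _ hg hFg, he _ hh hFh, he _ (H.mul_pow_mem hg hh hgh) hFgh]
    exact H.twist_mul hp hE hE1 (hEF.symm.subset hFg) (hEF.symm.subset hFh)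
  -- Either of `g`, `h` lying outside `ker π` can play the role of `F`; if neither does, the
  -- commutator is trivial and `χ` is already multiplicative.
  by_cases hg1 : π g = 1
  · by_cases hh1 : π h = 1
    · rw [extend_of_map_eq_one hg1, extend_of_map_eq_one hh1,
        extend_of_map_eq_one (by rw [map_mul, hg1, hh1, one_mul]),
        commutatorElement_eq_one_iff_commute.mpr (H.ker_comm g h hg1 hh1), H.char_one, one_pow,
        mul_one, H.char_mul g h hg1 hh1]
    · exact key h hh hh1 (commutator_mem_symm hgh) (hself h)
  · exact key g hg hg1 (hself g) hgh

end IsMonomialExtension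

/-! ### The monomial group: permutations, phases, scalars. -/

section MonomialGroup

variable {ι : Type*} [Fintype ι] [DecidableEq ι]

/-- The underlying matrix of an element of the monomial group. -/
def monomialSU.mat (g : monomialSU ι) : Matrix ι ι ℂ :=
  ((g : Matrix.unitaryGroup ι ℂ) : Matrix ι ι ℂ)

namespace monomialSU

theorem mat_injective : Function.Injective (mat : monomialSU ι → Matrix ι ι ℂ) := fun _ _ h =>
  Subtype.ext (Subtype.ext h)

@[simp] theorem mat_one : mat (1 : monomialSU ι) = 1 := rfl

@[simp] theorem mat_mul (g h : monomialSU ι) : mat (g * h) = mat g * mat h := rfl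

@[simp] theorem mat_pow (g : monomialSU ι) (m : ℕ) : mat (g ^ m) = mat g ^ m := by
  induction m with
  | zero => simp
  | succ m ih => rw [pow_succ, pow_succ, mat_mul, ih]

theorem det_mat (g : monomialSU ι) : (mat g).det = 1 :=
  (Matrix.mem_specialUnitaryGroup_iff.mp g.2.1).2

/-- The permutation underlying a monomial matrix. -/
noncomputable def perm (g : monomialSU ι) : Equiv.Perm ι := g.2.2.choose

/-- The phases of a monomial matrix. -/
noncomputable def phase (g : monomialSU ι) : ι → Circle := g.2.2.choose_spec.choose

theorem mat_eq (g : monomialSU ι) :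
    mat g = ((perm g)⁻¹).permMatrix ℂ * Matrix.diagonal fun q => (phase g q : ℂ) :=
  g.2.2.choose_spec.choose_spec

theorem mat_apply (g : monomialSU ι) (i j : ι) :
    mat g i j = if i = perm g j then (phase g j : ℂ) else 0 := by
  rw [mat_eq, monomial_apply]

theorem perm_apply_eq_iff (g : monomialSU ι) (i j : ι) : perm g j = i ↔ mat g i j ≠ 0 := by
  rw [mat_apply]
  by_cases h : i = perm g j
  · simp [h]
  · simp [h, Ne.symm h]

/-- The permutation underlying a monomial matrix, as a homomorphism. -/
noncomputable def permHom : monomialSU ι →* Equiv.Perm ι where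
  toFun := perm
  map_one' := by
    ext j
    rw [perm_apply_eq_iff]
    simp
  map_mul' g h := by
    ext j
    rw [perm_apply_eq_iff, mat_mul, Matrix.mul_apply]
    simp [mat_apply]

theorem mat_of_permHom_eq_one {g : monomialSU ι} (hg : permHom g = 1) :
    mat g = Matrix.diagonal fun q => (phase g q : ℂ) := by
  have h : perm g = 1 := hg
  ext i j
  rw [mat_apply, h, Matrix.diagonal_apply]
  by_cases hij : i = j <;> simp [hij]

variable (ι) in
/-- The scalar matrices in the monomial group. -/
def scalars : Subgroup (monomialSU ι) where
  carrier := {g | ∃ c : ℂ, mat g = c • 1}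
  one_mem' := ⟨1, by simp⟩
  mul_mem' := by
    rintro g h ⟨c, hc⟩ ⟨d, hd⟩
    exact ⟨c * d, by rw [mat_mul, hc, hd]; simp [smul_smul, mul_comm]⟩
  inv_mem' := by
    rintro g ⟨c, hc⟩
    refine ⟨star c, ?_⟩
    change star (mat g) = _
    rw [hc, star_smul, star_one]

theorem commute_of_mem_scalars {z : monomialSU ι} (hz : z ∈ scalars ι) (g : monomialSU ι) :
    Commute z g := by
  obtain ⟨c, hc⟩ := hz
  exact mat_injective (by simp [hc])

theorem commute_of_permHom_eq_one {g h : monomialSU ι} (hg : permHom g = 1) (hh : permHom h = 1) :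
    Commute g h :=
  mat_injective (by
    rw [mat_mul, mat_mul, mat_of_permHom_eq_one hg, mat_of_permHom_eq_one hh]
    exact Matrix.commute_diagonal _ _)

theorem mat_mul_apply_of_permHom_eq_one {g h : monomialSU ι} (hg : permHom g = 1) (i j : ι) :
    mat (g * h) i j = mat g i i * mat h i j := by
  simp [mat_of_permHom_eq_one hg]

theorem permHom_of_mem_scalars {z : monomialSU ι} (hz : z ∈ scalars ι) : permHom z = 1 := by
  obtain ⟨c, hc⟩ := hz
  ext j
  change perm z j = j
  rw [perm_apply_eq_iff]
  intro h0
  have h1 : mat z (perm z j) j ≠ 0 := (perm_apply_eq_iff z _ j).mp rfl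
  rw [hc] at h0 h1
  simp only [Matrix.smul_apply, Matrix.one_apply_eq, smul_eq_mul, mul_one] at h0
  simp [h0] at h1

theorem pow_card_of_mem_scalars {z : monomialSU ι} (hz : z ∈ scalars ι) :
    z ^ Fintype.card ι = 1 := by
  obtain ⟨c, hc⟩ := hz
  have := det_mat z
  rw [hc, Matrix.det_smul, Matrix.det_one, mul_one] at this
  apply mat_injective
  rw [mat_pow, hc, smul_pow, this]
  simp

/-- Phases accumulate along the orbit of `j`. -/
theorem mat_pow_apply (g : monomialSU ι) (m : ℕ) (j : ι) :
    mat (g ^ m) ((perm g ^ m) j) j = ∏ i ∈ Finset.range m, (phase g ((perm g ^ i) j) : ℂ) := by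
  induction m with
  | zero => simp
  | succ m ih =>
    rw [pow_succ' g, mat_mul, Matrix.mul_apply, Finset.prod_range_succ, ← ih,
      Finset.sum_eq_single ((perm g ^ m) j), mul_comm, mat_apply g, if_pos]
    · rw [pow_succ', Equiv.Perm.mul_apply]
    · intro b _ hb
      rw [mat_apply g, if_neg, zero_mul]
      rw [pow_succ', Equiv.Perm.mul_apply]
      exact fun h => hb ((perm g).injective h).symm
    · simp

end monomialSU

end MonomialGroup

/-! ### Permutations of order `p` and the extension axioms. -/

theorem exists_zpow_apply_of_prime {p : ℕ} [Fact p.Prime] {σ : Equiv.Perm (Fin p)} (h1 : σ ≠ 1)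
    (hσ : σ ^ p = 1) (i j : Fin p) : ∃ k : ℕ, k < p ∧ (σ ^ k) i = j := by
  have ho : orderOf σ = p := orderOf_eq_prime hσ h1
  have hc : σ.IsCycle := Equiv.Perm.isCycle_of_prime_order'' (by simpa using Fact.out)
    (by simpa using ho)
  have hs : σ.support = Finset.univ := by
    rw [← Finset.card_eq_iff_eq_univ, ← hc.orderOf, ho, Fintype.card_fin]
  have hmem : ∀ i, σ i ≠ i := fun i => by
    rw [← Equiv.Perm.mem_support, hs]
    exact Finset.mem_univ i
  obtain ⟨k, hk, h⟩ := (hc.sameCycle (hmem i) (hmem j)).exists_pow_eq'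
  exact ⟨k, ho ▸ hk, h⟩

namespace monomialSU

variable {p : ℕ} [Fact p.Prime]

omit [Fact p.Prime] in
theorem permHom_pow_eq_one {g : monomialSU (Fin p)} (hg : g ^ p ∈ scalars (Fin p)) :
    permHom g ^ p = 1 := by
  rw [← map_pow, permHom_of_mem_scalars hg]

/-- The orbit of 0 is everything, so the scalar `g ^ p` is the product of all phases. This is `det g
= 1`, because a permutation of odd order is even. -/
theorem pow_eq_one_of_permHom_ne_one (hp : Odd p) {g : monomialSU (Fin p)}
    (hg : g ^ p ∈ scalars (Fin p)) (h1 : permHom g ≠ 1) : g ^ p = 1 := by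
  have hσ : perm g ^ p = 1 := permHom_pow_eq_one hg
  have hsign : Equiv.Perm.sign (perm g) = 1 := by
    have := congrArg Equiv.Perm.sign hσ
    rw [map_pow, map_one] at this
    obtain h | h := Int.units_eq_one_or (Equiv.Perm.sign (perm g))
    · exact h
    · rw [h, hp.neg_one_pow] at this
      exact absurd this (by decide)
  have hprod : ∏ q, (phase g q : ℂ) = 1 := by
    have := det_mat g
    rwa [mat_eq, Matrix.det_mul, Matrix.det_diagonal, Matrix.det_permutation,
      Equiv.Perm.sign_inv, hsign, Units.val_one, Int.cast_one, one_mul] at this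
  obtain ⟨c, hc⟩ := hg
  have h0 := mat_pow_apply g p 0
  have hbij : Function.Bijective fun i : Fin p => (perm g ^ (i : ℕ)) 0 := by
    rw [← Finite.surjective_iff_bijective]
    intro j
    obtain ⟨k, hk, h⟩ := exists_zpow_apply_of_prime h1 hσ 0 j
    exact ⟨⟨k, hk⟩, h⟩
  rw [hσ, hc, ← Fin.prod_univ_eq_prod_range (fun i => (phase g ((perm g ^ i) 0) : ℂ)) p,
    hbij.prod_comp (fun q => (phase g q : ℂ)), hprod] at h0
  apply mat_injective
  have h2 : c = 1 := by simpa using h0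
  rw [hc, h2, one_smul, mat_one]

/-- Two permutations commuting with a transitive cycle coincide once they agree at 0. -/
theorem exists_permHom_eq_zpow {g h : monomialSU (Fin p)}
    (hg : g ^ p ∈ scalars (Fin p)) (h1 : permHom g ≠ 1) (hgh : ⁅g, h⁆ ∈ scalars (Fin p)) :
    ∃ m : ℤ, permHom h = permHom g ^ m := by
  have hσ := permHom_pow_eq_one hg
  have hc : Commute (permHom g) (permHom h) := by
    rw [← commutatorElement_eq_one_iff_commute, ← map_commutatorElement,
      permHom_of_mem_scalars hgh]
  obtain ⟨m, -, hm⟩ := exists_zpow_apply_of_prime h1 hσ 0 (permHom h 0)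
  refine ⟨m, Equiv.ext fun j => ?_⟩
  obtain ⟨k, -, rfl⟩ := exists_zpow_apply_of_prime h1 hσ 0 j
  rw [zpow_natCast, ← Equiv.Perm.mul_apply, ← Equiv.Perm.mul_apply, ← (hc.pow_left k).eq,
    Equiv.Perm.mul_apply, ← hm, ← Equiv.Perm.mul_apply, ← pow_add, ← pow_add, add_comm]

theorem isMonomialExtension (hp : Odd p) :
    IsMonomialExtension p permHom (scalars (Fin p)) fun g => mat g 0 0 where
  comm _ hz := commute_of_mem_scalars hz
  torsion z hz := by simpa using pow_card_of_mem_scalars hz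
  le_ker _ hz := permHom_of_mem_scalars hz
  ker_comm _ _ := commute_of_permHom_eq_one
  char_mul _ _ hg _ := mat_mul_apply_of_permHom_eq_one hg 0 0
  char_one := by simp
  pow_eq_one _ := pow_eq_one_of_permHom_ne_one hp
  exists_zpow _ _ := exists_permHom_eq_zpow

end monomialSU

/-! ### Tensor products and the tensor character. -/

theorem tensorMatrix_eq_smul_one {ι : Type*} [DecidableEq ι] {n : ℕ} {M : Fin n → Matrix ι ι ℂ}
    {w : ℂ} (hw : w ≠ 0) (h : tensorMatrix M = w • 1) (q : ι) :
    (∀ k, M k = M k q q • (1 : Matrix ι ι ℂ)) ∧ ∏ k, M k q q = w := by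
  have happ : ∀ i j : Fin n → ι, ∏ k, M k (i k) (j k) = w * (1 : Matrix _ _ ℂ) i j := fun i j =>
    congrFun (congrFun h i) j
  have hq : ∏ k, M k q q = w := by simpa using happ (fun _ => q) fun _ => q
  refine ⟨fun k => ?_, hq⟩
  have hne : ∏ l ∈ Finset.univ.erase k, M l q q ≠ 0 := by
    rw [← Finset.mul_prod_erase _ _ (Finset.mem_univ k)] at hq
    rintro h0
    rw [h0, mul_zero] at hq
    exact hw hq.symm
  -- Varying only slot `k` and freezing the other indices at `q` isolates `M k` up to a nonzero
  -- factor.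
  have hupd : ∀ i j, M k i j * ∏ l ∈ Finset.univ.erase k, M l q q =
      w * (1 : Matrix ι ι ℂ) i j := by
    intro i j
    have := happ (Function.update (fun _ => q) k i) (Function.update (fun _ => q) k j)
    rw [← Finset.mul_prod_erase _ _ (Finset.mem_univ k), Function.update_self,
      Function.update_self, Finset.prod_congr rfl (fun l hl => by
        rw [Function.update_of_ne (Finset.ne_of_mem_erase hl),
          Function.update_of_ne (Finset.ne_of_mem_erase hl)])] at this
    rw [this]
    by_cases hij : i = j
    · rw [hij, Matrix.one_apply_eq, Matrix.one_apply_eq]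
    · rw [Matrix.one_apply_ne hij, Matrix.one_apply_ne]
      exact fun he => hij (Function.update_injective _ k he)
  ext i j
  apply mul_right_cancel₀ hne
  rw [hupd, Matrix.smul_apply, smul_eq_mul, mul_right_comm, hupd, Matrix.one_apply_eq, mul_one]

namespace monomialSU

/-- The tensor product of monomial matrices as a homomorphism. -/
def tensor (ι : Type*) [Fintype ι] [DecidableEq ι] (n : ℕ) :
    (Fin n → monomialSU ι) →* Matrix.unitaryGroup (Fin n → ι) ℂ :=
  (tensorHom ι n).comp (MonoidHom.pi fun k => (monomialSU ι).subtype.comp (Pi.evalMonoidHom _ k))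

theorem coe_tensor {ι : Type*} [Fintype ι] [DecidableEq ι] {n : ℕ} (M : Fin n → monomialSU ι) :
    (tensor ι n M : Matrix (Fin n → ι) (Fin n → ι) ℂ) = tensorMatrix fun k => mat (M k) := rfl

theorem mem_tensorPower_iff {ι : Type*} [Fintype ι] [DecidableEq ι] {n : ℕ}
    {U : Matrix.unitaryGroup (Fin n → ι) ℂ} :
    U ∈ tensorPower (monomialSU ι) n ↔ ∃ M, tensor ι n M = U := by
  constructor
  · rintro ⟨M, hM, rfl⟩
    exact ⟨fun k => ⟨M k, hM k trivial⟩, rfl⟩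
  · rintro ⟨M, rfl⟩
    exact ⟨fun k => M k, fun k _ => (M k).2, rfl⟩

variable {p : ℕ} [Fact p.Prime] {n : ℕ}

theorem mem_scalars_of_tensor_eq {M : Fin n → monomialSU (Fin p)} {w : ℂ} (hw : w ≠ 0)
    (h : (tensor (Fin p) n M : Matrix (Fin n → Fin p) (Fin n → Fin p) ℂ) = w • 1) :
    (∀ k, M k ∈ scalars (Fin p)) ∧ ∏ k, mat (M k) 0 0 = w := by
  obtain ⟨h1, h2⟩ := tensorMatrix_eq_smul_one hw ((coe_tensor M).symm.trans h) 0
  exact ⟨fun k => ⟨_, h1 k⟩, h2⟩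

theorem mem_scalars_of_tensor_eq_one {M : Fin n → monomialSU (Fin p)}
    (h : tensor (Fin p) n M = 1) :
    (∀ k, M k ∈ scalars (Fin p)) ∧ ∏ k, mat (M k) 0 0 = 1 :=
  mem_scalars_of_tensor_eq one_ne_zero (by rw [h, one_smul]; rfl)

/-- The extension of the character `⊗ Mₖ ↦ ∏ Mₖ 0 0` from diagonal tensors. -/
noncomputable def tensorChar (M : Fin n → monomialSU (Fin p)) : ℂ :=
  ∏ k, IsMonomialExtension.extend p permHom (scalars (Fin p)) (fun g => mat g 0 0) (M k)

/-- A scalar tensor has scalar factors, where the extension is the plain entry. So on scalar tensors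
the value does not depend on the chosen factorisation. -/
theorem tensorChar_of_tensor_eq {M : Fin n → monomialSU (Fin p)} {w : ℂ} (hw : w ≠ 0)
    (h : (tensor (Fin p) n M : Matrix (Fin n → Fin p) (Fin n → Fin p) ℂ) = w • 1) :
    tensorChar M = w := by
  obtain ⟨h1, h2⟩ := mem_scalars_of_tensor_eq hw h
  rw [← h2]
  exact Finset.prod_congr rfl fun k _ =>
    IsMonomialExtension.extend_of_map_eq_one (permHom_of_mem_scalars (h1 k))

theorem tensorChar_one : tensorChar (1 : Fin n → monomialSU (Fin p)) = 1 :=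
  tensorChar_of_tensor_eq one_ne_zero (by rw [map_one, one_smul]; rfl)

theorem tensorChar_mul (hp : Odd p) {M N : Fin n → monomialSU (Fin p)}
    (hM : tensor (Fin p) n M ^ p = 1) (hN : tensor (Fin p) n N ^ p = 1)
    (hMN : Commute (tensor (Fin p) n M) (tensor (Fin p) n N)) :
    tensorChar (M * N) = tensorChar M * tensorChar N := by
  rw [← map_pow] at hM hN
  rw [← commutatorElement_eq_one_iff_commute, ← map_commutatorElement] at hMN
  obtain ⟨h1, -⟩ := mem_scalars_of_tensor_eq_one hM
  obtain ⟨h2, -⟩ := mem_scalars_of_tensor_eq_one hN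
  obtain ⟨h3, h4⟩ := mem_scalars_of_tensor_eq_one hMN
  have key : ∀ k, _ := fun k =>
    (isMonomialExtension hp).extend_mul hp (h1 k) (h2 k) (h3 k)
  simp only [tensorChar, Pi.mul_apply]
  rw [Finset.prod_congr rfl fun k _ => key k, Finset.prod_mul_distrib, Finset.prod_mul_distrib,
    Finset.prod_pow]
  -- The half commutators combine into a power of the scalar of the tensor commutator, which is 1.
  change _ * (∏ k, mat (⁅M, N⁆ k) 0 0) ^ _ = _
  rw [h4, one_pow, mul_one]

theorem tensorChar_list_prod (hp : Odd p) (L : List (Fin n → monomialSU (Fin p)))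
    (hL : ∀ M ∈ L, tensor (Fin p) n M ^ p = 1)
    (hc : ∀ M ∈ L, ∀ N ∈ L, Commute (tensor (Fin p) n M) (tensor (Fin p) n N)) :
    tensorChar L.prod = (L.map tensorChar).prod ∧ tensor (Fin p) n L.prod ^ p = 1 := by
  induction L with
  | nil => simp [tensorChar_one]
  | cons M L ih =>
    obtain ⟨h1, h2⟩ := ih (fun N hN => hL N (by simp [hN]))
      fun N hN N' hN' => hc N (by simp [hN]) N' (by simp [hN'])
    have hM := hL M (by simp)
    have hML : Commute (tensor (Fin p) n M) (tensor (Fin p) n L.prod) := by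
      rw [map_list_prod]
      refine Commute.list_prod_right _ _ fun x hx => ?_
      obtain ⟨N, hN, rfl⟩ := List.mem_map.mp hx
      exact hc M (by simp) N (by simp [hN])
    rw [List.prod_cons, List.map_cons, List.prod_cons, tensorChar_mul hp hM h2 hML, h1, map_mul,
      hML.mul_pow, hM, h2, one_mul]
    exact ⟨rfl, rfl⟩

theorem tensorChar_pow (hp : Odd p) {M : Fin n → monomialSU (Fin p)}
    (hM : tensor (Fin p) n M ^ p = 1) (a : ℕ) : tensorChar (M ^ a) = tensorChar M ^ a := by
  have := (tensorChar_list_prod hp (List.replicate a M)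
    (fun N hN => by rwa [List.eq_of_mem_replicate hN])
    (fun N hN N' hN' => by rw [List.eq_of_mem_replicate hN, List.eq_of_mem_replicate hN'])).1
  simpa using this

end monomialSU

/-! ### From quantum to classical solutions and back. -/

theorem pow_list_sum {G : Type*} [Monoid G] (z : G) (l : List ℕ) :
    z ^ l.sum = (l.map fun a => z ^ a).prod := by
  induction l with
  | nil => simp
  | cons a l ih => simp [pow_add, ih]

theorem isPrimitiveRoot_rootOmega (p : ℕ) [NeZero p] : IsPrimitiveRoot (rootOmega p) p :=
  Complex.isPrimitiveRoot_exp p (NeZero.ne p)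

open monomialSU in
theorem exists_mulVec_eq_of_quantum {p : ℕ} [Fact p.Prime] (hp : Odd p) {n r s : ℕ}
    {A : Matrix (Fin r) (Fin s) (ZMod p)} {b : Fin r → ZMod p}
    (M : Fin s → Fin n → monomialSU (Fin p)) (z : Matrix.unitaryGroup (Fin n → Fin p) ℂ)
    (hz : (z : Matrix (Fin n → Fin p) (Fin n → Fin p) ℂ) = rootOmega p • 1)
    (h1 : ∀ k, tensor (Fin p) n (M k) ^ p = 1)
    (h2 : ∀ j k k', A j k ≠ 0 → A j k' ≠ 0 →
      Commute (tensor (Fin p) n (M k)) (tensor (Fin p) n (M k')))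
    (h3 : ∀ j, lcsRowProd A (fun k => tensor (Fin p) n (M k)) j = z ^ (b j).val) :
    ∃ x : Fin s → ZMod p, A *ᵥ x = b := by
  have hω := isPrimitiveRoot_rootOmega p
  have hroot : ∀ k, ∃ i < p, rootOmega p ^ i = tensorChar (M k) := fun k => by
    refine hω.eq_pow_of_pow_eq_one ?_
    rw [← tensorChar_pow hp (h1 k)]
    refine tensorChar_of_tensor_eq one_ne_zero ?_
    rw [map_pow, h1, one_smul]
    rfl
  choose x _ hx using hroot
  refine ⟨fun k => (x k : ZMod p), funext fun j => ?_⟩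
  have hpow : ∀ a : ℕ, ((z ^ a : Matrix.unitaryGroup (Fin n → Fin p) ℂ) :
      Matrix (Fin n → Fin p) (Fin n → Fin p) ℂ) = rootOmega p ^ a • 1 := fun a => by
    rw [SubmonoidClass.coe_pow, hz, smul_pow, one_pow]
  have hrow : tensorChar (lcsRowProd A M j) = rootOmega p ^ (b j).val := by
    refine tensorChar_of_tensor_eq (pow_ne_zero _ (hω.ne_zero (NeZero.ne p))) ?_
    rw [← hpow, ← h3, lcsRowProd, lcsRowProd, map_list_prod, List.map_ofFn]
    simp [Function.comp_def]
  have hprod : tensorChar (lcsRowProd A M j) = ∏ k, tensorChar (M k) ^ (A j k).val := by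
    rw [lcsRowProd, (tensorChar_list_prod hp _ _ _).1, List.map_ofFn, List.prod_ofFn]
    · exact Finset.prod_congr rfl fun k _ => tensorChar_pow hp (h1 k) _
    · intro N hN
      obtain ⟨k, rfl⟩ := List.mem_ofFn.mp hN
      rw [map_pow, ← pow_mul, mul_comm, pow_mul, h1, one_pow]
    · intro N hN N' hN'
      obtain ⟨k, rfl⟩ := List.mem_ofFn.mp hN
      obtain ⟨k', rfl⟩ := List.mem_ofFn.mp hN'
      -- Commutation is only known for variables occurring in row `j`; the other factors are 1.
      by_cases hk : A j k = 0
      · simp [hk]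
      by_cases hk' : A j k' = 0
      · simp [hk']
      simpa using (h2 j k k' hk hk').pow_pow _ _
  rw [hprod] at hrow
  simp only [← hx, ← pow_mul, Finset.prod_pow_eq_pow_sum] at hrow
  rw [← pow_mod_orderOf, ← pow_mod_orderOf _ (b j).val, ← hω.eq_orderOf] at hrow
  have hmod := hω.pow_inj (Nat.mod_lt _ (NeZero.pos p)) (Nat.mod_lt _ (NeZero.pos p)) hrow
  have := (ZMod.natCast_eq_natCast_iff' _ _ p).mpr hmod
  simpa [Matrix.mulVec, dotProduct, mul_comm] using this

open monomialSU in
theorem exists_mem_tensorPower_eq_smul_one {p n : ℕ} [NeZero p] (hn : 1 ≤ n) :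
    ∃ z ∈ tensorPower (monomialSU (Fin p)) n,
      (z : Matrix (Fin n → Fin p) (Fin n → Fin p) ℂ) = rootOmega p • 1 := by
  have hω := isPrimitiveRoot_rootOmega p
  have hstar : star (rootOmega p) * rootOmega p = 1 := by
    rw [Complex.star_def, mul_comm, Complex.mul_conj, Complex.normSq_eq_norm_sq,
      hω.norm'_eq_one (NeZero.ne p)]
    simp
  have hu : rootOmega p • (1 : Matrix (Fin p) (Fin p) ℂ) ∈ Matrix.unitaryGroup (Fin p) ℂ := by
    rw [Matrix.mem_unitaryGroup_iff', star_smul, star_one, smul_mul_smul_comm, hstar]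
    simp
  obtain ⟨ζ, hζ⟩ : ∃ ζ : Circle, (ζ : ℂ) = rootOmega p :=
    ⟨⟨_, mem_sphere_zero_iff_norm.mpr (hω.norm'_eq_one (NeZero.ne p))⟩, rfl⟩
  have hmono : IsMonomialUnitary (rootOmega p • (1 : Matrix (Fin p) (Fin p) ℂ)) := by
    refine ⟨1, fun _ => ζ, ?_⟩
    ext i j
    rw [monomial_apply, hζ]
    by_cases h : i = j <;> simp [h]
  have hg : (⟨_, hu⟩ : Matrix.unitaryGroup (Fin p) ℂ) ∈ monomialSU (Fin p) := by
    refine ⟨Matrix.mem_specialUnitaryGroup_iff.mpr ⟨hu, ?_⟩, hmono⟩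
    rw [Matrix.det_smul, Matrix.det_one, Fintype.card_fin, hω.pow_eq_one, one_mul]
  -- Only one slot carries `ω`, so that the tensor is `ω` and not `ω ^ n`.
  refine ⟨tensor (Fin p) n (Pi.mulSingle ⟨0, hn⟩ ⟨_, hg⟩), mem_tensorPower_iff.mpr ⟨_, rfl⟩, ?_⟩
  rw [coe_tensor]
  have : (fun k => mat ((Pi.mulSingle ⟨0, hn⟩ ⟨_, hg⟩ : Fin n → monomialSU (Fin p)) k)) =
      fun k => (if k = ⟨0, hn⟩ then rootOmega p else 1) • (1 : Matrix (Fin p) (Fin p) ℂ) := by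
    funext k
    by_cases hk : k = ⟨0, hn⟩
    · subst hk
      simp [mat]
    · simp [hk]
  rw [this, ← tensorMatrix_one]
  ext i j
  simp only [tensorMatrix, Matrix.of_apply, Matrix.smul_apply, smul_eq_mul,
    Finset.prod_mul_distrib]
  simp

theorem mainTheorem1 (p : ℕ) [Fact p.Prime] (hp : Odd p) (n : ℕ) (hn : 1 ≤ n) (r s : ℕ)
    (A : Matrix (Fin r) (Fin s) (ZMod p)) (b : Fin r → ZMod p) :
    (∃ η : SolutionGroup A b →* tensorPower (monomialSU (Fin p)) n, IsQuantumSolution η) ↔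
      ∃ η : SolutionGroup A b →* Multiplicative (ZMod p), IsClassicalSolution η := by
  obtain ⟨z, hz, hzω⟩ := exists_mem_tensorPower_eq_smul_one (p := p) hn
  have hω := isPrimitiveRoot_rootOmega p
  have hzp : (⟨z, hz⟩ : tensorPower (monomialSU (Fin p)) n) ^ p = 1 := by
    apply Subtype.ext
    apply Subtype.ext
    simp [hzω, smul_pow, hω.pow_eq_one]
  have hzc : ∀ g : tensorPower (monomialSU (Fin p)) n, Commute g ⟨z, hz⟩ := fun g => by
    apply Subtype.ext
    apply Subtype.ext
    simp [hzω]
  rw [exists_isClassicalSolution_iff]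
  have hq : ∀ η : SolutionGroup A b →* tensorPower (monomialSU (Fin p)) n,
      IsQuantumSolution η ↔ η (SolutionGroup.J A b) = ⟨z, hz⟩ := fun η => by
    rw [IsQuantumSolution, ← hzω]
    exact ⟨fun h => Subtype.ext (Subtype.ext h), fun h => by rw [h]⟩
  simp only [hq]
  rw [SolutionGroup.exists_hom_iff _ hzp hzc]
  constructor
  · rintro ⟨y, h1, h2, h3⟩
    choose M hM using fun k => monomialSU.mem_tensorPower_iff.mp (y k).2
    refine exists_mulVec_eq_of_quantum hp M z hzω (fun k => ?_) (fun j k k' hk hk' => ?_)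
      fun j => ?_
    · rw [hM, ← SubmonoidClass.coe_pow, h1]
      rfl
    · rw [hM, hM]
      exact (h2 j k k' hk hk').map (Subgroup.subtype _)
    · have := congrArg (Subgroup.subtype _) (h3 j)
      simpa [lcsRowProd, map_list_prod, List.map_ofFn, Function.comp_def, hM] using this
  · rintro ⟨x, rfl⟩
    refine ⟨fun k => ⟨z, hz⟩ ^ (x k).val, fun k => ?_, fun _ k k' _ _ => ?_, fun j => ?_⟩
    · rw [← pow_mul, mul_comm, pow_mul, hzp, one_pow]
    · exact Commute.pow_pow_self _ _ _
    · have : (List.ofFn fun k => ((⟨z, hz⟩ : tensorPower (monomialSU (Fin p)) n) ^ (x k).val) ^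
          (A j k).val).prod = ⟨z, hz⟩ ^ ∑ k, (x k).val * (A j k).val := by
        rw [← List.sum_ofFn, pow_list_sum]
        simp only [List.map_ofFn, Function.comp_def, pow_mul]
      rw [lcsRowProd, this, pow_eq_pow_iff_modEq]
      refine Nat.ModEq.of_dvd (orderOf_dvd_of_pow_eq_one hzp) ?_
      rw [← ZMod.natCast_eq_natCast_iff]
      simp [Matrix.mulVec, dotProduct, mul_comm]
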